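/- **Definitions.** A *$C$-graph* $\Gamma$ is a directed graph with vertex set $V$ and edges labeled by vertices (write $e_{v_1,v_2,v_3}$ for an edge with tail $v_1$, head $v_2$ and label $v_3$) such that: (i) for every vertex $v$ the label map is a bijection from the edges with tail $v$ onto $V$, and from the edges with head $v$ onto $V$; (ii) the edge with tail $v$ and label $v$ is a loop; (iii) if the edge with tail $v_1$ and label $v_2$ is a loop, then so is the edge with tail $v_2$ and label $v_1$; (iv) for every edge $e_{v_1,v_2,v_3}$ and every vertex $v$, the path from $v$ along edges labeled $v_1,v_3$ and the path from $v$ along edges labeled $v_3,v_2$ have the same end; (v) if $K_\Gamma$ is the 2-complex obtained from $\Gamma$ by gluing in a quadrangle along the loop formed by the two paths in (iv), for each $v$ and each edge $e_{v_1,v_2,v_3}$, and if the loop $e_{v,v_1,v_2}\,e_{v,v_1,v_3}^{-1}$ is trivial in $\pi_1(K_\Gamma,v)$, then $v_2=v_3$. The *$C$-group* $G_\Gamma=(G,Y)$ is the group $G$ generated by $Y=\{y_v\mid v\in V\}$ with the defining relations $y_{v_3}^{-1}y_{v_1}y_{v_3}=y_{v_2}$, one for each edge $e_{v_1,v_2,v_3}$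 of $\Gamma$; it is a *finite $C$-group* if $\Gamma$ is finite. Its *factorization semigroup* $S(G,Y)$ is the semigroup (with unit the empty product) generated by letters $x_g$, $g\in Y$, with the defining relations $$x_{g_1}x_{g_2}=x_{g_2}x_{g_2^{-1}g_1g_2}=x_{g_1g_2g_1^{-1}}x_{g_1};$$ write $x_v=x_{y_v}$. Let $\alpha:S(G,Y)\to G$, $x_g\mapsto g$, be the product homomorphism, $\tau=\mathrm{ab}\circ\alpha:S(G,Y)\to G/[G,G]$ the type homomorphism, and $ln(s)$ the number of factors of $s$. An element $s\in S(G,Y)$ is *stabilizing* if $s_1s=s_2s$ for all $s_1,s_2\in S(G,Y)$ with $\alpha(s_1)=\alpha(s_2)$ and $\tau(s_1)=\tau(s_2)$; the semigroup $S(G,Y)$ is *stable* if it has a stabilizing element. Let $\Gamma$ be finite, and let $V_1,\dots,V_m$ be the vertex sets of its connected components, $V_i=\{v_{i,1},\dots,v_{i,n_i}\}$. Let $p_i$ be the period of the vertices $v\in V_i$, i.e. the smallest $p\ge 1$ such that, from every vertex of $\Gamma$, the path of length $p$ along edges labeled $v$ is a loop ($p_i$ does not depend on the choice of $v\in V_i$).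 Put $$s_\Gamma=\prod_{i=1}^m\prod_{j=1}^{n_i}x_{v_{i,j}}^{p_i},\qquad R=\Big\{\prod_{i,j}x_{v_{i,j}}^{k_{i,j}}\ \Big|\ k_{i,j}\ge 0,\ \sum_{j=1}^{n_i}k_{i,j}\le p_in_i,\ i=1,\dots,m\Big\},$$ where the products are taken in the order of a fixed numbering of the vertices. Call $s_1,s_2$ equivalent ($s_1\sim s_2$) if $s_3s_1s_4=s_3s_2s_4$ for some $s_3,s_4\in S(G,Y)$. For $s_1\sim s_2$ let $e(s_1,s_2)$ be the smallest $k\ge 0$ for which there is $s\in S(G,Y)$ with $ln(s)=k$ and $s_1s=s_2s$, and let $$e_\Gamma=\max\{e(s_1,s_2)\mid s_1,s_2\in R,\ s_1\sim s_2\}.$$ **Theorem.** Let $(G,Y)=G_\Gamma$ be a finite $C$-group. Then the factorization semigroup $S(G,Y)$ is stable, and $s_\Gamma^{e_\Gamma}$ is a stabilizing element of it: $s_1\cdot s_\Gamma^{e_\Gamma}=s_2\cdot s_\Gamma^{e_\Gamma}$ for all $s_1,s_2\in S(G,Y)$ with $\alpha(s_1)=\alpha(s_2)$ and $\tau(s_1)=\tau(s_2)$.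 -/

import Mathlib

universe u

/-- An equipped group `(G, O)`: a set `O` of elements of `G` that is invariant under all inner
automorphisms. -/
structure EquippedGroup (G : Type u) [Group G] where
  /-- The equipment. -/
  O : Set G
  conj_mem : ∀ a ∈ O, ∀ g : G, g * a * g⁻¹ ∈ O

namespace EquippedGroup

variable {G : Type u} [Group G] (P : EquippedGroup G)

/-- The element `b⁻¹ a b` of `O`. -/
def conjRight (a b : P.O) : P.O :=
  ⟨(b : G)⁻¹ * a * b, by simpa using P.conj_mem a a.2 (b : G)⁻¹⟩

/-- The element `a b a⁻¹` of `O`. -/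
def conjLeft (a b : P.O) : P.O :=
  ⟨(a : G) * b * (a : G)⁻¹, P.conj_mem b b.2 a⟩

/-- The defining relations
`x_a x_b = x_b x_{b⁻¹ a b}` and `x_a x_b = x_{a b a⁻¹} x_a` of the factorization semigroup. -/
inductive FactorizationRel : FreeMonoid P.O → FreeMonoid P.O → Prop
  | right (a b : P.O) : FactorizationRel
      (FreeMonoid.of a * FreeMonoid.of b) (FreeMonoid.of b * FreeMonoid.of (P.conjRight a b))
  | left (a b : P.O) : FactorizationRel
      (FreeMonoid.of a * FreeMonoid.of b) (FreeMonoid.of (P.conjLeft a b) * FreeMonoid.of a)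

/-- The factorization semigroup `S(G, O)` (with the empty product as its unit). -/
abbrev FactorizationSemigroup : Type u := PresentedMonoid P.FactorizationRel

/-- The generator `x_g` of `S(G, O)`, for `g ∈ O`. -/
def x (g : P.O) : P.FactorizationSemigroup := PresentedMonoid.of P.FactorizationRel g

/-- The product homomorphism `α : S(G, O) → G`, `x_g ↦ g`. -/
def productHom : P.FactorizationSemigroup →* G :=
  PresentedMonoid.lift (fun g : P.O => (g : G)) (by
    intro w₁ w₂ h
    cases h <;> simp [conjRight, conjLeft, mul_assoc])

/-- The length as a homomorphism to the additive monoid `ℕ`, `x_g ↦ 1`. -/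
def lengthHom : P.FactorizationSemigroup →* Multiplicative ℕ :=
  PresentedMonoid.lift (fun _ : P.O => Multiplicative.ofAdd 1) (by
    intro w₁ w₂ h
    cases h <;> simp)

/-- The length `ln(s)`: the number of factors of `s`. -/
def length (s : P.FactorizationSemigroup) : ℕ := Multiplicative.toAdd (P.lengthHom s)

/-- Equivalence `s₁ ∼ s₂` of elements of `S(G, O)`. -/
def Equivalent (s₁ s₂ : P.FactorizationSemigroup) : Prop :=
  ∃ s₃ s₄ : P.FactorizationSemigroup, s₃ * s₁ * s₄ = s₃ * s₂ * s₄

/-- The number `e(s₁, s₂)`: the smallest length of an element `s` with `s₁ s = s₂ s`. Such an `s`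
exists whenever `s₁` and `s₂` are equivalent. -/
noncomputable def e (s₁ s₂ : P.FactorizationSemigroup) : ℕ :=
  sInf {k : ℕ | ∃ s : P.FactorizationSemigroup, P.length s = k ∧ s₁ * s = s₂ * s}

end EquippedGroup

/-- Edge paths in the directed graph with vertex set `V` whose edges are labeled by vertices;
`edge v₁ v₂ a` says that there is an edge with tail `v₁`, head `v₂` and label `a`. Edges may be
traversed in both directions. -/
inductive EdgePath {V : Type u} (edge : V → V → V → Prop) : V → V → Type u
  | nil (v : V) : EdgePath edge v v
  | fwd {v₁ v₂ v : V} (a : V) (h : edge v₁ v₂ a) (p : EdgePath edge v₂ v) : EdgePath edge v₁ v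
  | bwd {v₁ v₂ v : V} (a : V) (h : edge v₂ v₁ a) (p : EdgePath edge v₂ v) : EdgePath edge v₁ v

/-- Homotopy (with fixed end points) of edge paths in the two-dimensional complex whose
1-skeleton is the labeled graph and which has, for each vertex `v` and each edge with tail `v₁`,
head `v₂` and label `v₃`, a quadrangle with one half of the boundary leading from `v` along the
edges labeled `v₁`, `v₃`, and the other half leading from `v` along the edges labeled `v₃`, `v₂`.
Equality in the fundamental groupoid of the complex is this relation. -/
inductive EdgePath.Homotopic {V : Type u} {edge : V → V → V → Prop} :
    ∀ {v w : V}, EdgePath edge v w → EdgePath edge v w → Prop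
  | refl {v w : V} (p : EdgePath edge v w) : EdgePath.Homotopic p p
  | symm {v w : V} {p q : EdgePath edge v w} :
      EdgePath.Homotopic p q → EdgePath.Homotopic q p
  | trans {v w : V} {p q r : EdgePath edge v w} :
      EdgePath.Homotopic p q → EdgePath.Homotopic q r → EdgePath.Homotopic p r
  | fwd_congr {v₁ v₂ w a : V} (h : edge v₁ v₂ a) {p q : EdgePath edge v₂ w} :
      EdgePath.Homotopic p q → EdgePath.Homotopic (.fwd a h p) (.fwd a h q)
  | bwd_congr {v₁ v₂ w a : V} (h : edge v₂ v₁ a) {p q : EdgePath edge v₂ w} :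
      EdgePath.Homotopic p q → EdgePath.Homotopic (.bwd a h p) (.bwd a h q)
  | fwd_bwd {v₁ v₂ w a : V} (h : edge v₁ v₂ a) (p : EdgePath edge v₁ w) :
      EdgePath.Homotopic (.fwd a h (.bwd a h p)) p
  | bwd_fwd {v₁ v₂ w a : V} (h : edge v₂ v₁ a) (p : EdgePath edge v₁ w) :
      EdgePath.Homotopic (.bwd a h (.fwd a h p)) p
  | quadrangle {v v₁ v₂ v₃ b c d w : V} (_ : edge v₁ v₂ v₃)
      (h₁ : edge v b v₁) (h₂ : edge b d v₃) (h₃ : edge v c v₃) (h₄ : edge c d v₂)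
      (p : EdgePath edge d w) :
      EdgePath.Homotopic (.fwd v₁ h₁ (.fwd v₃ h₂ p)) (.fwd v₃ h₃ (.fwd v₂ h₄ p))

/-- A `C`-graph with vertex set `V`. An edge is determined by its tail, its head and its label;
`Edge v₁ v₂ a` says that there is an edge with tail `v₁`, head `v₂` and label `a`. -/
structure CGraph (V : Type u) where
  Edge : V → V → V → Prop
  /-- The label map is a bijection from the edges with a given tail to the vertices. -/
  existsUnique_head : ∀ v a : V, ∃! w : V, Edge v w a
  /-- The label map is a bijection from the edges with a given head to the vertices. -/
  existsUnique_tail : ∀ v a : V, ∃! w : V, Edge w v a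
  /-- The edge with tail `v` and label `v` is a loop. -/
  self_loop : ∀ v w : V, Edge v w v → w = v
  /-- If the edge with tail `v₁` and label `v₂` is a loop, so is the one with tail `v₂` and label
  `v₁`. -/
  loop_symm : ∀ v₁ v₂ v₄ : V, Edge v₁ v₁ v₂ → Edge v₂ v₄ v₁ → v₂ = v₄
  /-- For an edge with tail `v₁`, head `v₂` and label `v₃`, the paths from any `v` along the labels
  `v₁, v₃` and along the labels `v₃, v₂` have the same end. -/
  path_ends : ∀ v₁ v₂ v₃ : V, Edge v₁ v₂ v₃ → ∀ v b c d d' : V,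
    Edge v b v₁ → Edge b d v₃ → Edge v c v₃ → Edge c d' v₂ → d = d'
  /-- If the loop formed by two edges with common tail and common head is contractible in the
  associated two-dimensional complex, then the two edges have the same label. -/
  label_eq : ∀ (v v₁ v₂ v₃ : V) (h₂ : Edge v v₁ v₂) (h₃ : Edge v v₁ v₃),
    EdgePath.Homotopic (EdgePath.fwd v₂ h₂ (EdgePath.bwd v₃ h₃ (EdgePath.nil v)))
      (EdgePath.nil v) → v₂ = v₃

namespace CGraph

variable {V : Type u} (Γ : CGraph V)

/-- `Γ.IsPath v [a₁, …, aₙ] w`: the positive path that starts at `v` and runs along edges with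
labels `a₁, …, aₙ` ends at `w`. -/
def IsPath : V → List V → V → Prop
  | v, [], w => v = w
  | v, a :: l, w => ∃ u : V, Γ.Edge v u a ∧ IsPath u l w

/-- The period of a vertex `v`: the smallest positive `p` such that, from every vertex, the path of
length `p` with all labels equal to `v` is a loop. It exists if `V` is finite. -/
noncomputable def period (v : V) : ℕ :=
  sInf {p : ℕ | 0 < p ∧ ∀ w : V, Γ.IsPath w (List.replicate p v) w}

/-- The set of connected components of the graph. -/
def Component : Type u := Quot (fun v w : V => ∃ a : V, Γ.Edge v w a)

/-- The connected component of a vertex. -/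
def component (v : V) : Γ.Component := Quot.mk _ v

/-- The relators `v₃⁻¹ v₁ v₃ v₂⁻¹`, one for each edge with tail `v₁`, head `v₂` and label `v₃`. -/
def relators : Set (FreeGroup V) :=
  {r | ∃ v₁ v₂ v₃ : V, Γ.Edge v₁ v₂ v₃ ∧
    r = (FreeGroup.of v₃)⁻¹ * FreeGroup.of v₁ * FreeGroup.of v₃ * (FreeGroup.of v₂)⁻¹}

/-- The group underlying the `C`-group `G_Γ`. -/
abbrev Grp : Type u := PresentedGroup Γ.relators

/-- The `C`-generator `y_v` of `G_Γ`. -/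
def y (v : V) : Γ.Grp := PresentedGroup.of v

theorem y_conj {v₁ v₂ v₃ : V} (h : Γ.Edge v₁ v₂ v₃) :
    (Γ.y v₃)⁻¹ * Γ.y v₁ * Γ.y v₃ = Γ.y v₂ := by
  have h1 := PresentedGroup.one_of_mem (rels := Γ.relators) ⟨v₁, v₂, v₃, h, rfl⟩
  simp only [map_mul, map_inv] at h1
  exact mul_inv_eq_one.mp h1

theorem conj_mem_range_y (g : Γ.Grp) :
    (∀ v, ∃ w, g * Γ.y v * g⁻¹ = Γ.y w) ∧ ∀ v, ∃ w, g⁻¹ * Γ.y v * g = Γ.y w := by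
  have hg : g ∈ Subgroup.closure (Set.range (PresentedGroup.of (rels := Γ.relators))) := by
    rw [PresentedGroup.closure_range_of]; trivial
  induction hg using Subgroup.closure_induction with
  | mem g hg =>
    obtain ⟨a, rfl⟩ := hg
    refine ⟨fun v => ?_, fun v => ?_⟩
    · obtain ⟨w, hw, -⟩ := Γ.existsUnique_tail v a
      refine ⟨w, ?_⟩
      rw [← Γ.y_conj hw]
      simp [y, mul_assoc]
    · obtain ⟨w, hw, -⟩ := Γ.existsUnique_head v a
      exact ⟨w, Γ.y_conj hw⟩
  | one => exact ⟨fun v => ⟨v, by simp⟩, fun v => ⟨v, by simp⟩⟩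
  | mul g h _ _ hg hh =>
    refine ⟨fun v => ?_, fun v => ?_⟩
    · obtain ⟨w, hw⟩ := hh.1 v
      obtain ⟨z, hz⟩ := hg.1 w
      exact ⟨z, by rw [← hz, ← hw]; group⟩
    · obtain ⟨w, hw⟩ := hg.2 v
      obtain ⟨z, hz⟩ := hh.2 w
      exact ⟨z, by rw [← hz, ← hw]; group⟩
  | inv g _ hg => exact ⟨by simpa using hg.2, by simpa using hg.1⟩

/-- The `C`-group `G_Γ = (G, Y)` as an equipped group; `Y` is the set of the `C`-generators. -/
def cGroup : EquippedGroup Γ.Grp where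
  O := Set.range Γ.y
  conj_mem := by
    rintro _ ⟨v, rfl⟩ g
    obtain ⟨w, hw⟩ := (Γ.conj_mem_range_y g).1 v
    exact ⟨w, hw.symm⟩

/-- The factorization semigroup `S(G, Y)` of the `C`-group `(G, Y) = G_Γ`. -/
abbrev S : Type u := Γ.cGroup.FactorizationSemigroup

/-- The generator `x_v = x_{y_v}` of `S(G, Y)`. -/
def x (v : V) : Γ.S := Γ.cGroup.x ⟨Γ.y v, v, rfl⟩

/-- The type homomorphism `τ = ab ∘ α : S(G, Y) → G / [G, G]`. -/
def typeHom : Γ.S →* Abelianization Γ.Grp := Abelianization.of.comp Γ.cGroup.productHom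

/-- `s` is a stabilizing element of `S(G, Y)`. -/
def IsStabilizing (s : Γ.S) : Prop :=
  ∀ s₁ s₂ : Γ.S, Γ.cGroup.productHom s₁ = Γ.cGroup.productHom s₂ →
    Γ.typeHom s₁ = Γ.typeHom s₂ → s₁ * s = s₂ * s

/-- `S(G, Y)` is stable. -/
def IsStable : Prop := ∃ s : Γ.S, Γ.IsStabilizing s

section Finite

variable [Fintype V] (num : Fin (Fintype.card V) ≃ V)

/-- The product `∏ x_v ^ k_v` over all vertices, in the order of a numbering of the vertices. -/
def orderedProd (k : V → ℕ) : Γ.S :=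
  (List.ofFn fun j => Γ.x (num j) ^ k (num j)).prod

/-- The canonical element `s_Γ = ∏ x_v ^ p_v` of `S(G, Y)`, where `p_v` is the period of `v`.
(Its factors are central, so that it does not depend on the numbering.) -/
noncomputable def canonicalElement : Γ.S := Γ.orderedProd num Γ.period

open Classical in
/-- The set `R` of the products `∏ x_v ^ k_v` such that, for each connected component, the sum of
the exponents over its vertices is at most `p n`, where `n` is the number of its vertices
and `p` their common period. -/
def R : Set Γ.S :=
  {s | ∃ k : V → ℕ, s = Γ.orderedProd num k ∧
    ∀ v : V, ∑ w with Γ.component w = Γ.component v, k w ≤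
      Γ.period v * Finset.card {w : V | Γ.component w = Γ.component v}}

/-- The number `e_Γ`: the maximum of `e(s₁, s₂)` over all pairs of equivalent elements of the
(finite) set `R`. -/
noncomputable def eΓ : ℕ :=
  sSup {k : ℕ | ∃ s₁ ∈ Γ.R num, ∃ s₂ ∈ Γ.R num,
    Γ.cGroup.Equivalent s₁ s₂ ∧ k = Γ.cGroup.e s₁ s₂}

end Finite

end CGraph

/-! In `S(G,Y)` moving a letter `x_w` past `x_v` replaces `w` by its image under the permutation
attached to the label `v`. Hence `x_v ^ p`, with `p` the period of `v`, is central.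

Central powers give cancellation: in the localization of `S(G,Y)` at its center every `x_v` is a
unit, so the map to the localization factors through `G`. Elements with the same product in `G`
therefore agree after multiplication by a central element (`exists_mul_eq_mul_of_productHom_eq`).
For a pair from `R`, some such multiplier has length at most `e_Γ`, and any element of that length
divides `s_Γ ^ e_Γ`.

The general case is reduced to `R` by induction on length. Both elements are brought to ordered
form; their exponent sums over each component agree, being determined by the product in `G`. If a
sum exceeds its bound, pigeonhole splits off central factors `x_v ^ p` and `x_w ^ p` with `v`, `w`
in that component. These have equal images in `G` and lie in `R`, so `s_Γ ^ e_Γ` identifies them,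
and the induction hypothesis handles the cofactors. -/

/-! ### Sorting words in a monoid -/

theorem List.exists_pairwise_le_map_prod_eq {ι M : Type*} [LinearOrder ι] [Finite ι] [Monoid M]
    (f : ι → M) (h : ∀ a b, ∃ c, f a * f b = f b * f c) (l : List ι) :
    ∃ l' : List ι, l'.Pairwise (· ≤ ·) ∧ (l'.map f).prod = (l.map f).prod := by
  let A : Set (List ι) := {l' | l'.length = l.length ∧ (l'.map f).prod = (l.map f).prod}
  have hA : A.Finite := (List.finite_length_eq ι l.length).subset fun _ hl => hl.1
  -- The lexicographically least word of the same length and product is sorted: at a descent `a >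
  -- b`, rewriting `a b` as `b c` gives a smaller word, whatever `c` is.
  obtain ⟨m, ⟨hm₁, hm₂⟩, hmin⟩ := Set.exists_min_image A id hA ⟨l, rfl, rfl⟩
  refine ⟨m, ?_, hm₂⟩
  rw [← List.isChain_iff_pairwise]
  by_contra hc
  obtain ⟨n, hn, hlt⟩ := List.exists_not_getElem_of_not_isChain hc
  rw [not_le] at hlt
  obtain ⟨c, hc⟩ := h m[n] m[n + 1]
  have hsplit : m = m.take n ++ m[n] :: m[n + 1] :: m.drop (n + 2) := by
    rw [List.cons_getElem_drop_succ, List.cons_getElem_drop_succ, List.take_append_drop]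
  have hle := hmin (m.take n ++ m[n + 1] :: c :: m.drop (n + 2)) ⟨by
      rw [← hm₁]
      conv_rhs => rw [hsplit]
      simp only [List.length_append, List.length_cons], by
      rw [← hm₂]
      conv_rhs => rw [hsplit]
      simp only [List.map_append, List.map_cons, List.prod_append, List.prod_cons]
      rw [← mul_assoc (f m[n]), hc, mul_assoc]⟩
  refine absurd hle (not_le.2 ?_)
  conv_rhs => rw [id, hsplit]
  exact List.append_left_lt (List.Lex.rel hlt)

theorem List.Pairwise.map_prod_eq_prod_ofFn {n : ℕ} {M : Type*} [Monoid M] (f : Fin n → M)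
    {l : List (Fin n)} (hl : l.Pairwise (· ≤ ·)) :
    (l.map f).prod = (List.ofFn fun j => f j ^ l.count j).prod := by
  have h : l = (List.finRange n).flatMap fun j => List.replicate (l.count j) j := by
    refine List.Perm.eq_of_pairwise' (r := (· ≤ ·)) hl ?_ ?_
    · rw [List.pairwise_flatMap]
      refine ⟨fun j _ => List.pairwise_replicate.2 (Or.inr le_rfl), ?_⟩
      refine (List.pairwise_lt_finRange n).imp fun {a b} hab x hx y hy => ?_
      rw [List.eq_of_mem_replicate hx, List.eq_of_mem_replicate hy]
      exact hab.le
    · rw [List.perm_iff_count]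
      intro a
      rw [List.count_flatMap]
      have : (List.count a ∘ fun j => List.replicate (l.count j) j) =
          fun j => if j = a then l.count a else 0 := by
        funext j
        by_cases hj : j = a
        · subst hj; simp
        · simp [List.count_replicate, hj]
      rw [this, ← List.ofFn_eq_map, List.sum_ofFn]
      simp
  conv_lhs => rw [h]
  rw [List.ofFn_eq_map]
  simp [List.flatMap, List.prod_flatten, List.map_flatten, Function.comp_def]

/-- The center of a monoid satisfies the Ore condition. -/
@[reducible] def Submonoid.centerOreSet (M : Type*) [Monoid M] :
    OreLocalization.OreSet (Submonoid.center M) where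
  ore_right_cancel a b s h :=
    ⟨s, by rw [← Submonoid.mem_center_iff.1 s.2, h, Submonoid.mem_center_iff.1 s.2]⟩
  oreNum a _ := a
  oreDenom _ s := s
  ore_eq a s := (Submonoid.mem_center_iff.1 s.2 a).symm

/-! ### Edge permutations and periods -/

namespace CGraph

variable {V : Type u} (Γ : CGraph V)

/-- The head of the edge with tail `v` and label `a`. -/
noncomputable def head (a v : V) : V := (Γ.existsUnique_head v a).choose

theorem edge_head (a v : V) : Γ.Edge v (Γ.head a v) a := (Γ.existsUnique_head v a).choose_spec.1

theorem edge_iff {a v w : V} : Γ.Edge v w a ↔ Γ.head a v = w :=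
  ⟨fun h => (Γ.existsUnique_head v a).unique (Γ.edge_head a v) h, fun h => h ▸ Γ.edge_head a v⟩

theorem head_bijective (a : V) : Function.Bijective (Γ.head a) := by
  refine ⟨fun v w h => ?_, fun w => ?_⟩
  · exact (Γ.existsUnique_tail (Γ.head a w) a).unique (h ▸ Γ.edge_head a v) (Γ.edge_head a w)
  · obtain ⟨v, hv, -⟩ := Γ.existsUnique_tail w a
    exact ⟨v, Γ.edge_iff.1 hv⟩

/-- The permutation of the vertices given by the edges with label `a`. -/
noncomputable def perm (a : V) : Equiv.Perm V := Equiv.ofBijective _ (Γ.head_bijective a)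

theorem edge_iff_perm {a v w : V} : Γ.Edge v w a ↔ Γ.perm a v = w := Γ.edge_iff

theorem isPath_replicate_iff {a : V} {n : ℕ} {v w : V} :
    Γ.IsPath v (List.replicate n a) w ↔ (Γ.perm a ^ n) v = w := by
  induction n generalizing v with
  | zero => simp [IsPath]
  | succ n ih => simp [List.replicate_succ, IsPath, edge_iff_perm, ih, pow_succ]

theorem perm_conj {v w a : V} (h : Γ.Edge v w a) :
    Γ.perm w = Γ.perm a * Γ.perm v * (Γ.perm a)⁻¹ := by
  rw [eq_mul_inv_iff_mul_eq]
  ext u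
  exact (Γ.path_ends v w a h u _ _ _ _ (Γ.edge_head v u) (Γ.edge_head a _) (Γ.edge_head a u)
    (Γ.edge_head w _)).symm

theorem period_eq_sInf (v : V) : Γ.period v = sInf {p : ℕ | 0 < p ∧ Γ.perm v ^ p = 1} := by
  simp only [period, isPath_replicate_iff, Equiv.ext_iff, Equiv.Perm.one_apply]

theorem period_eq_of_edge {v w a : V} (h : Γ.Edge v w a) : Γ.period v = Γ.period w := by
  simp only [period_eq_sInf, Γ.perm_conj h, conj_pow, mul_inv_eq_one, mul_eq_left]

theorem period_spec [Finite V] (v : V) : 0 < Γ.period v ∧ Γ.perm v ^ Γ.period v = 1 := by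
  rw [period_eq_sInf]
  exact Nat.sInf_mem (s := {p : ℕ | 0 < p ∧ Γ.perm v ^ p = 1})
    ⟨orderOf (Γ.perm v), orderOf_pos _, pow_orderOf_eq_one _⟩

/-! ### Commutation rules and central powers -/

@[simp] theorem productHom_x (v : V) : Γ.cGroup.productHom (Γ.x v) = Γ.y v := rfl

theorem x_eq (g : Γ.cGroup.O) : ∃ v, PresentedMonoid.of Γ.cGroup.FactorizationRel g = Γ.x v := by
  obtain ⟨_, v, rfl⟩ := g
  exact ⟨v, rfl⟩

theorem exists_map_x_prod_eq (s : Γ.S) : ∃ l : List V, (l.map Γ.x).prod = s := by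
  obtain ⟨w, rfl⟩ := PresentedMonoid.surjective_mk s
  induction w with
  | one => exact ⟨[], (map_one _).symm⟩
  | of g =>
    obtain ⟨v, hv⟩ := Γ.x_eq g
    exact ⟨[v], by rw [List.map_singleton, List.prod_singleton, ← hv]; rfl⟩
  | mul a b ha hb =>
    obtain ⟨k, hk⟩ := ha
    obtain ⟨l, hl⟩ := hb
    exact ⟨k ++ l, by rw [List.map_append, List.prod_append, hk, hl, map_mul]⟩

theorem x_mul_x (v a : V) : Γ.x v * Γ.x a = Γ.x a * Γ.x (Γ.perm a v) := by
  have h := PresentedMonoid.mk_eq_mk_of_rel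
    (EquippedGroup.FactorizationRel.right (P := Γ.cGroup) ⟨Γ.y v, v, rfl⟩ ⟨Γ.y a, a, rfl⟩)
  have hc : Γ.cGroup.conjRight ⟨Γ.y v, v, rfl⟩ ⟨Γ.y a, a, rfl⟩ =
      ⟨Γ.y (Γ.perm a v), Γ.perm a v, rfl⟩ :=
    Subtype.ext (Γ.y_conj (Γ.edge_head a v))
  rw [hc, map_mul, map_mul] at h
  exact h

theorem x_mul_x_pow (v a : V) (n : ℕ) :
    Γ.x v * Γ.x a ^ n = Γ.x a ^ n * Γ.x ((Γ.perm a ^ n) v) := by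
  induction n generalizing v with
  | zero => simp
  | succ n ih => rw [pow_succ', ← mul_assoc, x_mul_x, mul_assoc, ih, ← mul_assoc, pow_succ]; rfl

theorem x_pow_mul_x (v a : V) (n : ℕ) :
    Γ.x v ^ n * Γ.x a = Γ.x a * Γ.x (Γ.perm a v) ^ n := by
  induction n with
  | zero => simp
  | succ n ih => rw [pow_succ, mul_assoc, x_mul_x, ← mul_assoc, ih, mul_assoc, ← pow_succ]

theorem mem_center_of_commute_x {z : Γ.S} (h : ∀ v, Γ.x v * z = z * Γ.x v) :
    z ∈ Submonoid.center Γ.S := by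
  rw [Submonoid.mem_center_iff]
  intro s
  obtain ⟨l, rfl⟩ := Γ.exists_map_x_prod_eq s
  induction l with
  | nil => simp
  | cons v l ih =>
    simp only [List.map_cons, List.prod_cons]
    rw [mul_assoc, ih, ← mul_assoc, h, mul_assoc]

theorem x_pow_period_mem_center [Finite V] (v : V) :
    Γ.x v ^ Γ.period v ∈ Submonoid.center Γ.S :=
  Γ.mem_center_of_commute_x fun w => by
    rw [x_mul_x_pow, (Γ.period_spec v).2, Equiv.Perm.one_apply]

/-! ### Cancellation through localization at the center -/

/-- Two elements with the same product become equal after multiplication by a common factor. -/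
theorem exists_mul_eq_mul_of_productHom_eq [Finite V] {s₁ s₂ : Γ.S}
    (h : Γ.cGroup.productHom s₁ = Γ.cGroup.productHom s₂) : ∃ s, s₁ * s = s₂ * s := by
  let _ := Submonoid.centerOreSet Γ.S
  let L := OreLocalization (Submonoid.center Γ.S) Γ.S
  let φ : Γ.S →* L := OreLocalization.numeratorHom
  have hu (v : V) : IsUnit (φ (Γ.x v)) := by
    -- A positive power of `x_v` is central, hence inverted by the localization; so `x_v` itself
    -- becomes a unit.
    rw [← isUnit_pow_iff (Γ.period_spec v).1.ne', ← map_pow]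
    exact OreLocalization.numerator_isUnit ⟨_, Γ.x_pow_period_mem_center v⟩
  let u (v : V) : Lˣ := (hu v).unit
  have hrel : ∀ r ∈ Γ.relators, FreeGroup.lift u r = 1 := by
    rintro _ ⟨v₁, v₂, v₃, he, rfl⟩
    simp only [map_mul, map_inv, FreeGroup.lift_apply_of]
    rw [mul_inv_eq_one, mul_assoc, inv_mul_eq_iff_eq_mul]
    ext
    simp only [u, Units.val_mul, IsUnit.unit_spec, ← map_mul]
    rw [x_mul_x, Γ.edge_iff_perm.1 he]
  let ψ : Γ.Grp →* L := (Units.coeHom L).comp (PresentedGroup.toGroup hrel)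
  have hψ : ψ.comp Γ.cGroup.productHom = φ := by
    refine PresentedMonoid.ext _ fun g => ?_
    obtain ⟨v, hv⟩ := Γ.x_eq g
    rw [hv, MonoidHom.comp_apply, productHom_x]
    simp [ψ, y, u]
  have hφ : φ s₁ = φ s₂ := by simp only [← hψ, MonoidHom.comp_apply, h]
  -- Both fractions have denominator 1, so the two multipliers `a` and `b` coincide.
  obtain ⟨a, b, hab, hab'⟩ := OreLocalization.oreDiv_eq_iff.1 hφ
  have hb : (a : Γ.S) = b := by simpa using hab'
  subst hb
  refine ⟨a, ?_⟩
  rw [Submonoid.mem_center_iff.1 a.2, Submonoid.mem_center_iff.1 a.2]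
  exact hab.symm

theorem equivalent_of_productHom_eq [Finite V] {s₁ s₂ : Γ.S}
    (h : Γ.cGroup.productHom s₁ = Γ.cGroup.productHom s₂) : Γ.cGroup.Equivalent s₁ s₂ := by
  obtain ⟨s, hs⟩ := Γ.exists_mul_eq_mul_of_productHom_eq h
  exact ⟨1, s, by simpa using hs⟩

/-! ### Invariants of connected components -/

theorem period_eq_of_component_eq [Finite V] {v w : V} (h : Γ.component v = Γ.component w) :
    Γ.period v = Γ.period w ∧ Γ.y v ^ Γ.period v = Γ.y w ^ Γ.period w := by
  have hvw := Quot.eqvGen_exact h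
  clear h
  induction hvw with
  | rel v w h =>
    obtain ⟨a, ha⟩ := h
    have hp := Γ.period_eq_of_edge ha
    refine ⟨hp, ?_⟩
    -- Centrality turns this into `x_a x_v ^ p = x_a x_w ^ p` in the semigroup; only after passing
    -- to `G` can `x_a` be cancelled.
    have h1 := Γ.x_pow_mul_x v a (Γ.period v)
    rw [← Submonoid.mem_center_iff.1 (Γ.x_pow_period_mem_center v), Γ.edge_iff_perm.1 ha] at h1
    simpa [← hp] using congrArg Γ.cGroup.productHom h1
  | refl v => exact ⟨rfl, rfl⟩
  | symm v w _ ih => exact ⟨ih.1.symm, ih.2.symm⟩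
  | trans u v w _ _ ih₁ ih₂ =>
    exact ⟨ih₁.1.trans ih₂.1, ih₁.2.trans ih₂.2⟩

open Classical in
/-- The exponent sum over the generators in the component `c`, as a homomorphism. -/
noncomputable def componentDegree (c : Γ.Component) : Γ.Grp →* Multiplicative ℤ :=
  PresentedGroup.toGroup
    (f := fun v => Multiplicative.ofAdd (if Γ.component v = c then (1 : ℤ) else 0)) (by
      rintro _ ⟨v₁, v₂, v₃, h, rfl⟩
      have hc : Γ.component v₁ = Γ.component v₂ := Quot.sound ⟨v₃, h⟩
      simp only [map_mul, map_inv, FreeGroup.lift_apply_of, hc]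
      rw [mul_inv_eq_one, mul_comm, mul_inv_cancel_left])

open Classical in
theorem componentDegree_y (c : Γ.Component) (v : V) : Γ.componentDegree c (Γ.y v) =
    Multiplicative.ofAdd (if Γ.component v = c then (1 : ℤ) else 0) :=
  PresentedGroup.toGroup.of _

@[simp] theorem length_mul (s t : Γ.S) :
    Γ.cGroup.length (s * t) = Γ.cGroup.length s + Γ.cGroup.length t := by
  simp [EquippedGroup.length]

theorem length_x_pow (v : V) (n : ℕ) : Γ.cGroup.length (Γ.x v ^ n) = n := by
  have h : Γ.cGroup.lengthHom (Γ.x v) = Multiplicative.ofAdd 1 := rfl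
  simp [EquippedGroup.length, h, ← ofAdd_nsmul]

theorem length_map_x_prod (l : List V) : Γ.cGroup.length (l.map Γ.x).prod = l.length := by
  induction l with
  | nil => simp [EquippedGroup.length]
  | cons v l ih =>
    have := Γ.length_x_pow v 1
    rw [pow_one] at this
    simp [ih, this, add_comm]

theorem exists_period_le {k : V → ℕ} {v : V} {A : Finset V}
    (hA : ∀ w ∈ A, Γ.period w = Γ.period v) (h : Γ.period v * A.card < ∑ w ∈ A, k w) :
    ∃ w ∈ A, Γ.period w ≤ k w := by
  by_contra! hc
  refine absurd h (not_lt.2 ?_)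
  rw [mul_comm, ← smul_eq_mul]
  exact Finset.sum_le_card_nsmul _ _ _ fun w hw => (hA w hw ▸ hc w hw).le

/-! ### Ordered products and divisors of the canonical element -/

section Finite

variable [Fintype V] (num : Fin (Fintype.card V) ≃ V)

theorem exists_eq_orderedProd (s : Γ.S) : ∃ k : V → ℕ, s = Γ.orderedProd num k := by
  obtain ⟨l, rfl⟩ := Γ.exists_map_x_prod_eq s
  obtain ⟨l', hl', h⟩ := List.exists_pairwise_le_map_prod_eq (fun j => Γ.x (num j))
    (fun a b => ⟨num.symm (Γ.perm (num b) (num a)), by simpa using Γ.x_mul_x _ _⟩) (l.map num.symm)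
  refine ⟨fun v => l'.count (num.symm v), ?_⟩
  rw [hl'.map_prod_eq_prod_ofFn] at h
  simpa [orderedProd, Function.comp_def] using h.symm

open Classical in
theorem componentDegree_orderedProd (c : Γ.Component) (k : V → ℕ) :
    Γ.componentDegree c (Γ.cGroup.productHom (Γ.orderedProd num k)) =
      Multiplicative.ofAdd ((∑ w with Γ.component w = c, k w : ℕ) : ℤ) := by
  have h : Γ.componentDegree c (Γ.cGroup.productHom (Γ.orderedProd num k)) =
      ∏ v, Γ.componentDegree c (Γ.y v) ^ k v := by
    rw [orderedProd, map_list_prod, map_list_prod, List.map_ofFn, List.map_ofFn, List.prod_ofFn]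
    simpa using Equiv.prod_comp num fun v => Γ.componentDegree c (Γ.y v) ^ k v
  rw [h]
  simp only [componentDegree_y, ← ofAdd_nsmul]
  rw [← ofAdd_sum, Finset.sum_filter]
  congr 1
  push_cast
  exact Finset.sum_congr rfl fun v _ => by split_ifs <;> simp

open Classical in
-- The cofactors `s`, `t` do not depend on `n`, so the exponent of `x_v` can be split without
-- disturbing the other factors.
theorem exists_orderedProd_eq_mul (k : V → ℕ) (v : V) : ∃ s t : Γ.S, ∀ n : ℕ,
    Γ.orderedProd num (Function.update k v n) = s * Γ.x v ^ n * t := by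
  obtain ⟨l₁, l₂, hl⟩ := List.append_of_mem (List.mem_finRange (num.symm v))
  have hnd := List.nodup_finRange (Fintype.card V)
  rw [hl, List.nodup_append] at hnd
  obtain ⟨-, hnd₂, hnd₁⟩ := hnd
  rw [List.nodup_cons] at hnd₂
  refine ⟨(l₁.map fun j => Γ.x (num j) ^ k (num j)).prod,
    (l₂.map fun j => Γ.x (num j) ^ k (num j)).prod, fun n => ?_⟩
  rw [orderedProd, List.ofFn_eq_map, hl, List.map_append, List.prod_append, List.map_cons,
    List.prod_cons, mul_assoc]
  congr 2
  · refine List.map_congr_left fun j hj => ?_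
    have : num j ≠ v := fun h => hnd₁ j hj (num.symm v) (by simp) (by simp [← h])
    simp [this]
  · simp
  · congr 1
    refine List.map_congr_left fun j hj => ?_
    have : num j ≠ v := fun h => hnd₂.1 (by simpa [← h] using hj)
    simp [this]

theorem exists_orderedProd_eq_x_pow_period_mul {k : V → ℕ} {v : V} (h : Γ.period v ≤ k v) :
    ∃ s : Γ.S, Γ.orderedProd num k = Γ.x v ^ Γ.period v * s := by
  classical
  obtain ⟨s, t, hst⟩ := Γ.exists_orderedProd_eq_mul num k v
  refine ⟨s * Γ.x v ^ (k v - Γ.period v) * t, ?_⟩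
  have h1 := hst (k v)
  rw [Function.update_eq_self] at h1
  conv_lhs => rw [h1, ← Nat.add_sub_of_le h, pow_add, ← mul_assoc,
    Submonoid.mem_center_iff.1 (Γ.x_pow_period_mem_center v)]
  simp only [mul_assoc]

theorem x_dvd_canonicalElement (v : V) : ∃ t, Γ.canonicalElement num = Γ.x v * t := by
  obtain ⟨s, hs⟩ := Γ.exists_orderedProd_eq_x_pow_period_mul num (le_refl (Γ.period v))
  refine ⟨Γ.x v ^ (Γ.period v - 1) * s, ?_⟩
  rw [canonicalElement, hs, ← mul_assoc, mul_pow_sub_one (Γ.period_spec v).1.ne']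

theorem canonicalElement_mem_center : Γ.canonicalElement num ∈ Submonoid.center Γ.S := by
  refine list_prod_mem fun s hs => ?_
  obtain ⟨j, rfl⟩ := List.mem_ofFn.1 hs
  exact Γ.x_pow_period_mem_center _

/-- Each central copy of `s_Γ` supplies one letter of `s` as a left factor. -/
theorem exists_canonicalElement_pow_eq_mul (s : Γ.S) {n : ℕ} (h : Γ.cGroup.length s ≤ n) :
    ∃ t, Γ.canonicalElement num ^ n = s * t := by
  obtain ⟨l, rfl⟩ := Γ.exists_map_x_prod_eq s
  rw [length_map_x_prod] at h
  induction l generalizing n with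
  | nil => exact ⟨Γ.canonicalElement num ^ n, by simp⟩
  | cons v l ih =>
    obtain ⟨n, rfl⟩ : ∃ m, n = m + 1 := ⟨n - 1, by simp at h; omega⟩
    obtain ⟨t, ht⟩ := ih (n := n) (by simpa using h)
    obtain ⟨t', ht'⟩ := Γ.x_dvd_canonicalElement num v
    refine ⟨t * t', ?_⟩
    have hc := Submonoid.mem_center_iff.1
      (pow_mem (Γ.canonicalElement_mem_center num) n) t'
    rw [pow_succ']
    nth_rw 1 [ht']
    rw [mul_assoc, hc, ht]
    simp [mul_assoc]

/-! ### The finite set `R` and the bound `e_Γ` -/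

theorem finite_R : (Γ.R num).Finite := by
  classical
  refine ((Set.finite_Iic fun v : V => Γ.period v *
    Finset.card {w : V | Γ.component w = Γ.component v}).image (Γ.orderedProd num)).subset ?_
  rintro s ⟨k, rfl, hk⟩
  refine ⟨k, fun v => le_trans ?_ (hk v), rfl⟩
  exact Finset.single_le_sum (f := k) (fun _ _ => Nat.zero_le _) (by simp)

/-- Finiteness of `R` makes the supremum defining `e_Γ` a genuine bound rather than the default
value 0. -/
theorem e_le_eΓ {s₁ s₂ : Γ.S} (h₁ : s₁ ∈ Γ.R num) (h₂ : s₂ ∈ Γ.R num)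
    (h : Γ.cGroup.Equivalent s₁ s₂) : Γ.cGroup.e s₁ s₂ ≤ Γ.eΓ num := by
  refine le_csSup ?_ ⟨s₁, h₁, s₂, h₂, h, rfl⟩
  refine (((Γ.finite_R num).prod (Γ.finite_R num)).image
    fun p => Γ.cGroup.e p.1 p.2).subset ?_ |>.bddAbove
  rintro _ ⟨t₁, ht₁, t₂, ht₂, -, rfl⟩
  exact ⟨(t₁, t₂), ⟨ht₁, ht₂⟩, rfl⟩

theorem mul_canonicalElement_pow_eq_of_mem_R {s₁ s₂ : Γ.S} (h₁ : s₁ ∈ Γ.R num)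
    (h₂ : s₂ ∈ Γ.R num) (h : Γ.cGroup.productHom s₁ = Γ.cGroup.productHom s₂) :
    s₁ * Γ.canonicalElement num ^ Γ.eΓ num = s₂ * Γ.canonicalElement num ^ Γ.eΓ num := by
  obtain ⟨s, hs⟩ := Γ.exists_mul_eq_mul_of_productHom_eq h
  -- A common multiplier exists, so the infimum defining `e` is attained, here by `t`.
  obtain ⟨t, ht, hst⟩ := Nat.sInf_mem
    (s := {k : ℕ | ∃ s : Γ.S, Γ.cGroup.length s = k ∧ s₁ * s = s₂ * s}) ⟨_, s, rfl, hs⟩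
  obtain ⟨r, hr⟩ := Γ.exists_canonicalElement_pow_eq_mul num t
    (ht.le.trans (Γ.e_le_eΓ num h₁ h₂ (Γ.equivalent_of_productHom_eq h)))
  rw [hr, ← mul_assoc, hst, mul_assoc]

open Classical in
theorem orderedProd_single (v : V) (n : ℕ) : Γ.orderedProd num (Pi.single v n) = Γ.x v ^ n := by
  have h : (fun j => Γ.x (num j) ^ (Pi.single v n : V → ℕ) (num j)) =
      Pi.mulSingle (num.symm v) (Γ.x v ^ n) := by
    funext j
    by_cases hj : num j = v
    · subst hj; simp
    · have hj' : j ≠ num.symm v := fun h => hj (by simp [h])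
      simp [hj, hj']
  rw [orderedProd, h, List.ofFn_eq_map]
  have key : ∀ l : List (Fin (Fintype.card V)), l.Nodup → num.symm v ∈ l →
      (l.map (Pi.mulSingle (num.symm v) (Γ.x v ^ n) : _ → Γ.S)).prod = Γ.x v ^ n := by
    intro l hl hv
    rw [List.prod_map_eq_pow_single (num.symm v) _ fun j hj _ => Pi.mulSingle_eq_of_ne hj _,
      List.count_eq_one_of_mem hl hv, pow_one, Pi.mulSingle_eq_same]
  exact key _ (List.nodup_finRange _) (List.mem_finRange _)

theorem x_pow_period_mem_R (v : V) : Γ.x v ^ Γ.period v ∈ Γ.R num := by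
  classical
  refine ⟨Pi.single v (Γ.period v), ?_, fun u => ?_⟩
  · exact (Γ.orderedProd_single num v _).symm
  · rw [Finset.sum_pi_single']
    split_ifs with h
    · rw [(Γ.period_eq_of_component_eq (Finset.mem_filter.1 h).2).1]
      exact Nat.le_mul_of_pos_right _ (Finset.card_pos.2 ⟨u, by simp⟩)
    · exact Nat.zero_le _

/-! ### Reduction to `R` by induction on length -/

theorem mul_canonicalElement_pow_eq {s₁ s₂ : Γ.S}
    (h : Γ.cGroup.productHom s₁ = Γ.cGroup.productHom s₂) :
    s₁ * Γ.canonicalElement num ^ Γ.eΓ num = s₂ * Γ.canonicalElement num ^ Γ.eΓ num := by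
  classical
  induction hn : Γ.cGroup.length s₁ using Nat.strong_induction_on generalizing s₁ s₂ with
  | _ n ih =>
  obtain ⟨k₁, hk₁⟩ := Γ.exists_eq_orderedProd num s₁
  obtain ⟨k₂, hk₂⟩ := Γ.exists_eq_orderedProd num s₂
  have hsum (c : Γ.Component) :
      ∑ w with Γ.component w = c, k₁ w = ∑ w with Γ.component w = c, k₂ w := by
    have := congrArg (Γ.componentDegree c) h
    rw [hk₁, hk₂, componentDegree_orderedProd, componentDegree_orderedProd] at this
    exact_mod_cast Multiplicative.ofAdd.injective this
  by_cases hR : ∀ v : V, ∑ w with Γ.component w = Γ.component v, k₁ w ≤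
      Γ.period v * Finset.card {w : V | Γ.component w = Γ.component v}
  · refine Γ.mul_canonicalElement_pow_eq_of_mem_R num ⟨k₁, hk₁, fun v => ?_⟩
      ⟨k₂, hk₂, fun v => ?_⟩ h
    · convert hR v
    · convert hsum _ ▸ hR v
  · push Not at hR
    obtain ⟨u, hu⟩ := hR
    have hp (w : V) (hw : w ∈ ({w : V | Γ.component w = Γ.component u} : Finset V)) :
        Γ.period w = Γ.period u :=
      (Γ.period_eq_of_component_eq (Finset.mem_filter.1 hw).2).1
    obtain ⟨v, hv, hkv⟩ := Γ.exists_period_le hp hu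
    obtain ⟨w, hw, hkw⟩ := Γ.exists_period_le hp (hsum _ ▸ hu)
    obtain ⟨t₁, ht₁⟩ := Γ.exists_orderedProd_eq_x_pow_period_mul num hkv
    obtain ⟨t₂, ht₂⟩ := Γ.exists_orderedProd_eq_x_pow_period_mul num hkw
    have hvw := (Γ.period_eq_of_component_eq
      ((Finset.mem_filter.1 hv).2.trans (Finset.mem_filter.1 hw).2.symm)).2
    have hx := Γ.mul_canonicalElement_pow_eq_of_mem_R num (Γ.x_pow_period_mem_R num v)
      (Γ.x_pow_period_mem_R num w) (by simpa using hvw)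
    rw [ht₁] at hk₁
    rw [ht₂] at hk₂
    have ht : Γ.cGroup.productHom t₁ = Γ.cGroup.productHom t₂ := by
      rw [hk₁, hk₂] at h
      simpa [hvw] using h
    have hlt : Γ.cGroup.length t₁ < n := by
      rw [← hn, hk₁, length_mul, length_x_pow]
      exact Nat.lt_add_of_pos_left (Γ.period_spec v).1
    have hz := Submonoid.mem_center_iff.1
      (pow_mem (Γ.canonicalElement_mem_center num) (Γ.eΓ num))
    -- With `z = s_Γ ^ e_Γ` central: `x_v ^ p t₁ z = x_v ^ p t₂ z = x_v ^ p z t₂ = x_w ^ p z t₂ =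
    -- x_w ^ p t₂ z`.
    rw [hk₁, hk₂, mul_assoc, mul_assoc, ih _ hlt ht rfl, hz t₂, ← mul_assoc, hx, mul_assoc]

end Finite

end CGraph

theorem mainTheorem5 {V : Type*} [Fintype V] (Γ : CGraph V)
    (num : Fin (Fintype.card V) ≃ V) :
    Γ.IsStable ∧ Γ.IsStabilizing (Γ.canonicalElement num ^ Γ.eΓ num) := by
  have h : Γ.IsStabilizing (Γ.canonicalElement num ^ Γ.eΓ num) :=
    fun _ _ h _ => Γ.mul_canonicalElement_pow_eq num h
  exact ⟨⟨_, h⟩, h⟩
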